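/- Let $d\ge 2$, let $q_1,\dots,q_d$ be pairwise coprime positive integers, $\Gamma=q_1\mathbb Z\oplus\cdots\oplus q_d\mathbb Z$, $Q=q_1\cdots q_d$ and $W=\{n\in\mathbb Z^d: 0\le n_j\le q_j-1,\ j=1,\dots,d\}$. For a $\Gamma$-periodic function $V:\mathbb Z^d\to\mathbb C$ and $k\in\mathbb R^d$ let $D_V(k)$ be the $Q\times Q$ matrix, indexed by $W$, of the discrete Schrödinger operator $(\Delta+V)u(n)=\sum_{\|n'-n\|_1=1}u(n')+V(n)u(n)$ acting on the functions $u:\mathbb Z^d\to\mathbb C$ with $u(n+q_j\mathbf e_j)=e^{2\pi \mathbf i k_j}u(n)$ for all $n\in\mathbb Z^d$ and $1\le j\le d$ (such a function being identified with its restriction to $W$), and let $P_V(k,\lambda)=\det(D_V(k)-\lambda I)$. For $\lambda_1,\lambda_2\in\mathbb C$ and a non-empty set $S\subset\{1,\dots,d\}$, two $\Gamma$-periodic functions $V$ and $Y$ are called generalized partially Fermi isospectral with respect to $\lambda_1,\lambda_2,S$ if there are $k_j^*\in\mathbb R$ for $j\notin S$ such that $P_V(k,\lambda_1)=P_Y(k,\lambda_2)$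 for all $k\in\mathbb R^d$ with $k_j=k_j^*$ for every $j\notin S$. Theorem. Let $V:\mathbb Z^d\to\mathbb R$ be $\Gamma$-periodic and let $Y_0\in\mathbb R$ be a constant. Suppose that for all $1\le s<t\le d$ there are $\lambda_1(s,t),\lambda_2(s,t)\in\mathbb C$ and a set $S(s,t)\subset\{1,\dots,d\}$ with $s,t\in S(s,t)$ and $\#S(s,t)\ge 3$ such that $V$ and the constant potential $Y\equiv Y_0$ are generalized partially Fermi isospectral with respect to $\lambda_1(s,t),\lambda_2(s,t),S(s,t)$. Then $V$ is constant, and for all $1\le s<t\le d$, $$V\equiv[V]=Y_0+\lambda_1(s,t)-\lambda_2(s,t),\qquad\text{where } [V]=\frac1Q\sum_{n\in W}V(n).$$ -/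

import Mathlib

noncomputable section

namespace PeriodicSchrodinger

/-- `V` is `Γ`-periodic for the lattice `Γ = q₁ℤ ⊕ ⋯ ⊕ q_dℤ`. -/
def IsPeriodic {d : ℕ} {α : Type*} (q : Fin d → ℕ) (V : (Fin d → ℤ) → α) : Prop :=
  ∀ (n : Fin d → ℤ) (j : Fin d), V (n + Pi.single j (q j : ℤ)) = V n

/-- The fundamental domain `W = {n : 0 ≤ n_j ≤ q_j - 1}` of `Γ`. -/
abbrev Cell {d : ℕ} (q : Fin d → ℕ) : Type := (j : Fin d) → Fin (q j)

/-- The inclusion of the fundamental domain into `ℤ^d`. -/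
def cellPoint {d : ℕ} {q : Fin d → ℕ} (n : Cell q) : Fin d → ℤ := fun j => ((n j : ℕ) : ℤ)

/-- The average `[V] = Q⁻¹ ∑_{n ∈ W} V(n)`, where `Q = q₁ ⋯ q_d`. -/
def average {d : ℕ} (q : Fin d → ℕ) (V : (Fin d → ℤ) → ℝ) : ℝ :=
  (1 / ((∏ j, q j : ℕ) : ℝ)) * ∑ n : Cell q, V (cellPoint n)

/-- The discrete Laplacian on `ℤ^d`: the sum over the nearest neighbours `n ± e_j`. -/
def laplacian {d : ℕ} (u : (Fin d → ℤ) → ℂ) (n : Fin d → ℤ) : ℂ :=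
  ∑ j : Fin d, (u (n + Pi.single j 1) + u (n - Pi.single j 1))

/-- The discrete Schrödinger operator `Δ + V`. -/
def schrodinger {d : ℕ} (V u : (Fin d → ℤ) → ℂ) (n : Fin d → ℤ) : ℂ :=
  laplacian u n + V n * u n

/-- The Floquet–Bloch boundary condition `u(n + q_j e_j) = e^{2πi k_j} u(n)`. -/
def IsFloquet {d : ℕ} (q : Fin d → ℕ) (k : Fin d → ℂ) (u : (Fin d → ℤ) → ℂ) : Prop :=
  ∀ (n : Fin d → ℤ) (j : Fin d),
    u (n + Pi.single j (q j : ℤ)) = Complex.exp (2 * Real.pi * Complex.I * k j) * u n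

/-- The function satisfying the Floquet–Bloch boundary condition which is `1` at `n' ∈ W` and `0`
at the other points of `W`. It is supported on `n' + Γ`. -/
def floquetBasis {d : ℕ} (q : Fin d → ℕ) (k : Fin d → ℂ) (n' : Cell q) (m : Fin d → ℤ) : ℂ :=
  open Classical in
  if ∀ j, (q j : ℤ) ∣ m j - cellPoint n' j then
    Complex.exp (2 * Real.pi * Complex.I *
      ∑ j, k j * (((m j - cellPoint n' j) / (q j : ℤ) : ℤ) : ℂ))
  else 0

theorem floquetBasis_isFloquet {d : ℕ} (q : Fin d → ℕ) (hq : ∀ j, 0 < q j) (k : Fin d → ℂ)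
    (n' : Cell q) : IsFloquet q k (floquetBasis q k n') := by
  classical
  intro m i
  have hdiv : ∀ j, (q j : ℤ) ∣ (m + (Pi.single i (q i : ℤ) : Fin d → ℤ)) j - cellPoint n' j ↔
      (q j : ℤ) ∣ m j - cellPoint n' j := by
    intro j
    by_cases h : j = i
    · subst h
      rw [Pi.add_apply, Pi.single_eq_same, add_sub_right_comm]
      exact dvd_add_self_right
    · simp [Pi.single_eq_of_ne h]
  unfold floquetBasis
  simp only [hdiv]
  split_ifs with h
  · rw [← Complex.exp_add]
    congr 1
    have key : ∀ j, k j * ((((m + (Pi.single i (q i : ℤ) : Fin d → ℤ)) j - cellPoint n' j) / (q j : ℤ) : ℤ) : ℂ) =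
        k j * (((m j - cellPoint n' j) / (q j : ℤ) : ℤ) : ℂ) + if j = i then k j else 0 := by
      intro j
      by_cases hj : j = i
      · subst hj
        have hne : (q j : ℤ) ≠ 0 := by exact_mod_cast (hq j).ne'
        rw [Pi.add_apply, Pi.single_eq_same, add_sub_right_comm,
          Int.add_ediv_of_dvd_left (h j), Int.ediv_self hne]
        push_cast
        simp
        ring
      · simp [Pi.single_eq_of_ne hj, hj]
    simp only [key, Finset.sum_add_distrib, Finset.sum_ite_eq', Finset.mem_univ, if_true]
    ring
  · simp

theorem floquetBasis_cellPoint {d : ℕ} (q : Fin d → ℕ) (k : Fin d → ℂ) (n n' : Cell q) :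
    floquetBasis q k n' (cellPoint n) = if n = n' then 1 else 0 := by
  classical
  unfold floquetBasis
  by_cases h : n = n'
  · subst h
    simp
  · rw [if_neg h, if_neg]
    intro hdiv
    apply h
    funext j
    have h1 : (n j : ℕ) ≡ (n' j : ℕ) [MOD q j] :=
      ((Nat.modEq_iff_dvd).2 (hdiv j)).symm
    exact Fin.ext (h1.eq_of_lt_of_lt (n j).2 (n' j).2)

/-- The `Q × Q` Floquet matrix `D_V(k)`: the matrix of `Δ + V` acting on the functions that satisfy
the Floquet–Bloch boundary condition, in the basis `floquetBasis`. -/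
def floquetMatrix {d : ℕ} (q : Fin d → ℕ) (V : (Fin d → ℤ) → ℂ) (k : Fin d → ℂ) :
    Matrix (Cell q) (Cell q) ℂ :=
  Matrix.of fun n n' => schrodinger V (floquetBasis q k n') (cellPoint n)

/-- `P_V(k, λ) = det (D_V(k) - λ I)`. -/
def dispersion {d : ℕ} (q : Fin d → ℕ) (V : (Fin d → ℤ) → ℂ) (k : Fin d → ℂ) (lam : ℂ) : ℂ :=
  (floquetMatrix q V k - lam • (1 : Matrix (Cell q) (Cell q) ℂ)).det

/-- `V` and `Y` are generalized partially Fermi isospectral with respect to `lam₁`, `lam₂` and `S`.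
Only the values of `kstar` off `S` matter. -/
def GenPartiallyFermiIsospectral {d : ℕ} (q : Fin d → ℕ) (V Y : (Fin d → ℤ) → ℂ)
    (lam₁ lam₂ : ℂ) (S : Finset (Fin d)) : Prop :=
  S.Nonempty ∧ ∃ kstar : Fin d → ℝ, ∀ k : Fin d → ℝ, (∀ j, j ∉ S → k j = kstar j) →
    dispersion q V (fun j => (k j : ℂ)) lam₁ = dispersion q Y (fun j => (k j : ℂ)) lam₂

end PeriodicSchrodinger

end

/-! In the plane-wave basis the Floquet matrix is a diagonal matrix with entries `∑ j, (ρ n j * z j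
+ (ρ n j * z j)⁻¹)`, `ρ n j` roots of unity of order dividing `q j`, plus the Fourier matrix of the
potential (`dispersion_eq`). Three coordinates of `S` are kept free; the others are frozen and only
shift the diagonal by a common `c`.

Putting `z = x⁻¹ w` and comparing the coefficients of low order in `x` shows that, with `L_n =
linForm (ρ n) w`, the sums of `B n n / L_n` and of `B n m * B m n / (L_n * L_m)` are the same for
both potentials (`trace_eq_of_floquet_det_eq`). The first gives equality of the shifted averages. As
the Fourier matrix of a real potential is Hermitian, the second then becomes `∑ |K n m|² / (L_n *
L_m) = 0` over `n ≠ m`.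

Poles separate the terms of this identity (`coefficients_eq_zero`). The residue along `w₀ + w₁ + w₂
= 0`, followed by a residue on that plane, groups the `m` whose forms vanish on a common line; by
coprimality of the `q j` the terms of a group carry equal weights, or weights with equal negative
real part. Nonnegative coefficients therefore vanish one by one. So the zero-frequency row of the
Fourier matrix is diagonal, and the potential is constant. -/

/-! ### Power traces from the determinant of a quadratic pencil. -/

open Polynomial in
/-- The determinant of `1 + xM + x²Z`, as a polynomial in `x`. -/
noncomputable def quadraticPencilDet {ι : Type*} [Fintype ι] [DecidableEq ι] (M Z : Matrix ι ι ℂ) : ℂ[X] :=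
  (1 + (X : ℂ[X]) • (M.map C + (X : ℂ[X]) • Z.map C)).det

section Pencil

open Polynomial Matrix

variable {ι : Type*} [Fintype ι] [DecidableEq ι]

theorem infinite_unit_circle : {z : ℂ | ‖z‖ = 1}.Infinite := by
  have : Infinite (Set.Ioc (-Real.pi) Real.pi) :=
    (Set.Ioc_infinite (by linarith [Real.pi_pos])).to_subtype
  have : Infinite Circle := Circle.argEquiv.infinite_iff.2 this
  refine (Set.infinite_range_of_injective (f := fun z : Circle => (z : ℂ))
    Circle.coe_injective).mono ?_
  rintro _ ⟨z, rfl⟩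
  exact Circle.norm_coe z

theorem eval_quadraticPencilDet (M Z : Matrix ι ι ℂ) (x : ℂ) :
    (quadraticPencilDet M Z).eval x = (1 + x • M + x ^ 2 • Z).det := by
  rw [quadraticPencilDet, ← coe_evalRingHom, RingHom.map_det]
  congr 1
  ext i j
  simp only [RingHom.mapMatrix_apply, Matrix.map_apply, Matrix.add_apply, Matrix.smul_apply,
    smul_eq_mul, coe_evalRingHom, eval_add, eval_mul, eval_X, eval_C, Matrix.one_apply]
  split_ifs <;> simp <;> ring

theorem coeff_one_quadraticPencilDet (M Z : Matrix ι ι ℂ) :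
    (quadraticPencilDet M Z).coeff 1 = M.trace := by
  rw [quadraticPencilDet, Matrix.det_one_add_smul]
  have h : (M.map (C : ℂ → ℂ[X]) + (X : ℂ[X]) • Z.map C).trace = C M.trace + X * C Z.trace := by
    simp [Matrix.trace, map_sum, Finset.sum_add_distrib, Finset.mul_sum, X_mul_C]
  rw [h]
  -- The remainder of the expansion is multiplied by `X ^ 2`, so its value is irrelevant.
  generalize Polynomial.eval (R := ℂ[X]) _ _ = p
  simp [coeff_one, add_mul, mul_assoc, coeff_C_mul, coeff_mul_X_pow', mul_comm X]

/-- In `(1 + xM + x²Z)(1 - xM + x²Z)` the linear term cancels, so the expansion of `det (1 + tA)` to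
first order, at `t = x²`, already reaches the trace of `M * M`. -/
theorem coeff_two_quadraticPencilDet_mul (M Z : Matrix ι ι ℂ) :
    (quadraticPencilDet M Z * (quadraticPencilDet M Z).comp (-X)).coeff 2 =
      2 * Z.trace - (M * M).trace := by
  have h1 : (quadraticPencilDet M Z).comp (-X) =
      (1 - (X : ℂ[X]) • (M.map C - (X : ℂ[X]) • Z.map C)).det := by
    rw [quadraticPencilDet, ← coe_compRingHom_apply, RingHom.map_det]
    congr 1
    ext1 i j
    simp only [RingHom.mapMatrix_apply, Matrix.map_apply, Matrix.add_apply, Matrix.sub_apply,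
      Matrix.smul_apply, smul_eq_mul, coe_compRingHom_apply, add_comp, mul_comp, X_comp, C_comp,
      Matrix.one_apply]
    split_ifs <;> simp <;> ring
  have h2 : (1 + (X : ℂ[X]) • (M.map C + (X : ℂ[X]) • Z.map C)) *
      (1 - (X : ℂ[X]) • (M.map C - (X : ℂ[X]) • Z.map C)) =
      1 + (X ^ 2 : ℂ[X]) • ((2 : ℂ[X]) • Z.map C - (M * M).map C
        + (X : ℂ[X]) • ((M * Z).map C - (Z * M).map C + (X : ℂ[X]) • (Z * Z).map C)) := by
    simp only [Matrix.map_mul, smul_add, smul_sub, mul_sub, add_mul, mul_one, one_mul,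
      Matrix.smul_mul, Matrix.mul_smul, smul_smul]
    module
  have h3 : ((2 : ℂ[X]) • Z.map C - (M * M).map C
        + (X : ℂ[X]) • ((M * Z).map C - (Z * M).map C + (X : ℂ[X]) • (Z * Z).map C)).trace =
      C (2 * Z.trace - (M * M).trace) + (C (Z * Z).trace * X) * X := by
    have h (A : Matrix ι ι ℂ) : (A.map (C : ℂ → ℂ[X])).trace = C A.trace := by
      simp [Matrix.trace, map_sum]
    simp only [Matrix.trace_add, Matrix.trace_sub, Matrix.trace_smul, h, smul_eq_mul,
      Matrix.trace_mul_comm Z M]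
    rw [map_sub, map_mul, map_ofNat]
    ring
  rw [h1, quadraticPencilDet, ← Matrix.det_mul, h2, Matrix.det_one_add_smul, h3]
  generalize Polynomial.eval (R := ℂ[X]) _ _ = p
  have h4 : (1 + (C (2 * Z.trace - (M * M).trace) + (C (Z * Z).trace * X) * X) * X ^ 2
      + p * (X ^ 2) ^ 2 : ℂ[X]) = 1 + C (2 * Z.trace - (M * M).trace) * X ^ 2
      + C (Z * Z).trace * X ^ 4 + p * X ^ 4 := by ring
  rw [h4]
  simp only [coeff_add, coeff_one, coeff_mul_X_pow']
  norm_num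

/-- Two quadratic pencils with the same quadratic part and the same determinant on the unit circle
have linear parts with the same first two power traces. -/
theorem trace_eq_of_pencil_det_eq (M N Z : Matrix ι ι ℂ)
    (h : ∀ x : ℂ, ‖x‖ = 1 → (1 + x • M + x ^ 2 • Z).det = (1 + x • N + x ^ 2 • Z).det) :
    M.trace = N.trace ∧ (M * M).trace = (N * N).trace := by
  have hp : quadraticPencilDet M Z = quadraticPencilDet N Z := by
    refine Polynomial.eq_of_infinite_eval_eq _ _ (infinite_unit_circle.mono fun x hx => ?_)
    change eval x _ = eval x _
    simpa only [eval_quadraticPencilDet] using h x hx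
  refine ⟨by rw [← coeff_one_quadraticPencilDet M Z, hp, coeff_one_quadraticPencilDet], ?_⟩
  have := coeff_two_quadraticPencilDet_mul M Z
  rw [hp, coeff_two_quadraticPencilDet_mul] at this
  linear_combination this

end Pencil

/-! ### Rational identities in the linear forms, from Floquet determinants. -/

/-- The linear form with coefficients `ρ`. -/
def linForm {σ : Type*} [Fintype σ] (ρ w : σ → ℂ) : ℂ := ∑ i, ρ i * w i

section LinearForms

open Matrix

variable {ι : Type*} [Fintype ι] [DecidableEq ι] {σ : Type*} [Fintype σ]

/-- Scaling the Floquet variables to infinity along a direction `w` compares the first two power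
traces. -/
theorem trace_eq_of_floquet_det_eq (ρ : ι → σ → ℂ) (B B' : Matrix ι ι ℂ)
    (h : ∀ z : σ → ℂ, (∀ i, ‖z i‖ = 1) →
      (diagonal (fun n => ∑ i, (ρ n i * z i + (ρ n i * z i)⁻¹)) + B).det =
        (diagonal (fun n => ∑ i, (ρ n i * z i + (ρ n i * z i)⁻¹)) + B').det)
    (w : σ → ℂ) (hw : ∀ i, ‖w i‖ = 1) (hL : ∀ n, linForm (ρ n) w ≠ 0) :
    ∑ n, B n n / linForm (ρ n) w = ∑ n, B' n n / linForm (ρ n) w ∧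
      ∑ n, ∑ m, B n m * B m n / (linForm (ρ n) w * linForm (ρ m) w) =
        ∑ n, ∑ m, B' n m * B' m n / (linForm (ρ n) w * linForm (ρ m) w) := by
  set Λ : ι → ℂ := fun n => linForm (ρ n) w with hΛ
  set D : Matrix ι ι ℂ := diagonal fun n => (Λ n)⁻¹ with hD
  set Z : Matrix ι ι ℂ := D * diagonal fun n => ∑ i, (ρ n i * w i)⁻¹ with hZ
  have hDΛ : diagonal Λ * D = 1 := by
    rw [hD, diagonal_mul_diagonal, ← diagonal_one]
    congr 1
    funext n
    exact mul_inv_cancel₀ (hL n)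
  -- With `z = x⁻¹ w`, which stays on the torus, multiplication by `x` makes the forms the constant
  -- term and sends their inverses to order `x²`; `Z` does not involve `A`.
  have key (A : Matrix ι ι ℂ) (x : ℂ) (hx : ‖x‖ = 1) :
      x ^ Fintype.card ι * (diagonal (fun n => ∑ i, (ρ n i * (x⁻¹ * w i) +
        (ρ n i * (x⁻¹ * w i))⁻¹)) + A).det =
        (diagonal Λ).det * (1 + x • (D * A) + x ^ 2 • Z).det := by
    have hx0 : x ≠ 0 := by rintro rfl; simp at hx
    rw [← det_smul, ← det_mul, mul_add, mul_add, Matrix.mul_smul, Matrix.mul_smul, hZ,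
      ← mul_assoc, ← mul_assoc, hDΛ, one_mul, one_mul, mul_one, smul_add, ← diagonal_smul,
      ← diagonal_smul, add_right_comm, diagonal_add]
    congr 3
    funext n
    simp only [hΛ, linForm, Pi.smul_apply, smul_eq_mul, Finset.mul_sum, ← Finset.sum_add_distrib]
    refine Finset.sum_congr rfl fun i _ => ?_
    simp only [mul_inv, inv_inv]
    field_simp
  have hdet : (diagonal Λ).det ≠ 0 := by
    rw [det_diagonal]
    exact Finset.prod_ne_zero_iff.2 fun n _ => hL n
  have := trace_eq_of_pencil_det_eq (D * B) (D * B') Z fun x hx => by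
    refine mul_left_cancel₀ hdet ?_
    rw [← key B x hx, ← key B' x hx, h]
    intro i
    rw [norm_mul, norm_inv, hx, hw, inv_one, one_mul]
  have tr1 (A : Matrix ι ι ℂ) : (D * A).trace = ∑ n, A n n / Λ n := by
    simp only [Matrix.trace, diag_apply, hD, diagonal_mul]
    exact Finset.sum_congr rfl fun n _ => by ring
  have tr2 (A : Matrix ι ι ℂ) :
      (D * A * (D * A)).trace = ∑ n, ∑ m, A n m * A m n / (Λ n * Λ m) := by
    have hDA (n m : ι) : (D * A) n m = (Λ n)⁻¹ * A n m := by rw [hD, diagonal_mul]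
    simp only [Matrix.trace, diag_apply]
    refine Finset.sum_congr rfl fun n _ => ?_
    rw [Matrix.mul_apply]
    refine Finset.sum_congr rfl fun m _ => ?_
    rw [hDA, hDA, div_eq_mul_inv, mul_inv]
    ring
  rwa [tr1, tr1, tr2, tr2] at this

/-- The vanishing of a double sum `∑ h n m / (L_n L_m)` extends from the torus to all points. -/
theorem double_sum_eq_zero_of_torus (ρ : ι → σ → ℂ) (hρ : ∀ n, ρ n ≠ 0) (g : ι → ι → ℂ)
    (h : ∀ w : σ → ℂ, (∀ i, ‖w i‖ = 1) → (∀ n, linForm (ρ n) w ≠ 0) →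
      ∑ n, ∑ m, g n m / (linForm (ρ n) w * linForm (ρ m) w) = 0)
    (w : σ → ℂ) (hw : ∀ n, linForm (ρ n) w ≠ 0) :
    ∑ n, ∑ m, g n m / (linForm (ρ n) w * linForm (ρ m) w) = 0 := by
  classical
  let ℓ : ι → MvPolynomial σ ℂ := fun n => ∑ i, MvPolynomial.C (ρ n i) * MvPolynomial.X i
  let P : MvPolynomial σ ℂ := ∏ n, ℓ n
  let q : MvPolynomial σ ℂ := ∑ n, ∑ m, MvPolynomial.C (g n m) *
    ((∏ k ∈ Finset.univ.erase n, ℓ k) * (∏ k ∈ Finset.univ.erase m, ℓ k))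
  have hℓ (n : ι) (w : σ → ℂ) : MvPolynomial.eval w (ℓ n) = linForm (ρ n) w := by
    simp [ℓ, linForm, map_sum]
  have hP (w : σ → ℂ) : MvPolynomial.eval w P = ∏ n, linForm (ρ n) w := by
    simp only [P, map_prod, hℓ]
  have hq (w : σ → ℂ) (hw : ∀ n, linForm (ρ n) w ≠ 0) : MvPolynomial.eval w q =
      (∏ n, linForm (ρ n) w) ^ 2 *
        ∑ n, ∑ m, g n m / (linForm (ρ n) w * linForm (ρ m) w) := by
    simp only [q, map_sum, map_mul, map_prod, hℓ, MvPolynomial.eval_C, Finset.mul_sum]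
    refine Finset.sum_congr rfl fun n _ => Finset.sum_congr rfl fun m _ => ?_
    rw [sq]
    nth_rewrite 1 [← Finset.mul_prod_erase _ _ (Finset.mem_univ n)]
    rw [← Finset.mul_prod_erase _ _ (Finset.mem_univ m)]
    have h1 := hw n
    have h2 := hw m
    field_simp
  have hP0 : P ≠ 0 := by
    refine Finset.prod_ne_zero_iff.2 fun n _ h0 => hρ n (funext fun i => ?_)
    have := hℓ n (Pi.single i 1)
    rw [h0] at this
    simpa [linForm, Pi.single_apply] using this.symm
  -- The factor `P` handles the torus points where some form vanishes, about which `h` says nothing.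
  have hPq : P * q = 0 := by
    refine MvPolynomial.funext_set (fun _ => {z : ℂ | ‖z‖ = 1}) (fun _ => infinite_unit_circle)
      fun w hw => ?_
    rw [map_mul, map_zero, hP]
    by_cases h0 : ∀ n, linForm (ρ n) w ≠ 0
    · rw [hq w h0, h w (fun i => hw i (Set.mem_univ i)) h0, mul_zero, mul_zero]
    · push Not at h0
      obtain ⟨n, hn⟩ := h0
      rw [Finset.prod_eq_zero (Finset.mem_univ n) hn, zero_mul]
  have hq0 := hq w hw
  rw [(mul_eq_zero.1 hPq).resolve_left hP0, map_zero] at hq0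
  exact (mul_eq_zero.1 hq0.symm).resolve_left
    (pow_ne_zero 2 (Finset.prod_ne_zero_iff.2 fun n _ => hw n))

end LinearForms

/-! ### Pole coefficients as limits at `ε = 0`. -/

section Poles

open Filter Topology

variable {ι : Type*}

theorem eventually_add_mul_ne_zero {a b : ℂ} (h : a = 0 → b ≠ 0) :
    ∀ᶠ ε in 𝓝[≠] (0 : ℂ), a + b * ε ≠ 0 := by
  by_cases ha : a = 0
  · filter_upwards [self_mem_nhdsWithin] with ε hε
    rw [ha, zero_add]
    exact mul_ne_zero (h ha) hε
  · have : Tendsto (fun ε : ℂ => a + b * ε) (𝓝[≠] 0) (𝓝 (a + b * 0)) :=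
      (Continuous.tendsto (by fun_prop) _).mono_left nhdsWithin_le_nhds
    rw [mul_zero, add_zero] at this
    exact this.eventually_ne ha

open Classical in
theorem tendsto_div_add_mul {a b : ℂ} (h : a = 0 → b ≠ 0) :
    Tendsto (fun ε : ℂ => ε / (a + b * ε)) (𝓝[≠] 0) (𝓝 (if a = 0 then b⁻¹ else 0)) := by
  split_ifs with ha
  · refine tendsto_const_nhds.congr' ?_
    filter_upwards [self_mem_nhdsWithin] with ε (hε : ε ≠ 0)
    rw [ha, zero_add]
    have := h ha
    field_simp
  · have : Tendsto (fun ε : ℂ => ε / (a + b * ε)) (𝓝[≠] 0) (𝓝 (0 / (a + b * 0))) := by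
      refine Tendsto.mono_left (ContinuousAt.tendsto ?_) nhdsWithin_le_nhds
      exact continuousAt_id.div (by fun_prop) (by simpa using ha)
    rwa [zero_div] at this

theorem tendsto_inv_add_mul {a : ℂ} (b : ℂ) (ha : a ≠ 0) :
    Tendsto (fun ε : ℂ => (a + b * ε)⁻¹) (𝓝[≠] 0) (𝓝 a⁻¹) := by
  have : Tendsto (fun ε : ℂ => (a + b * ε)⁻¹) (𝓝[≠] 0) (𝓝 (a + b * 0)⁻¹) :=
    Tendsto.mono_left (ContinuousAt.tendsto (ContinuousAt.inv₀ (by fun_prop) (by simpa using ha)))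
      nhdsWithin_le_nhds
  rwa [mul_zero, add_zero] at this

open Classical in
theorem simple_pole_residue (s : Finset ι) (a b c : ι → ℂ) (hab : ∀ n ∈ s, a n = 0 → b n ≠ 0)
    (h : ∀ᶠ ε in 𝓝[≠] (0 : ℂ), ∑ n ∈ s, c n / (a n + b n * ε) = 0) :
    ∑ n ∈ s with a n = 0, c n / b n = 0 := by
  have h1 : Tendsto (fun ε : ℂ => ∑ n ∈ s, c n * (ε / (a n + b n * ε))) (𝓝[≠] 0)
      (𝓝 (∑ n ∈ s, c n * (if a n = 0 then (b n)⁻¹ else 0))) :=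
    tendsto_finsetSum _ fun n hn => (tendsto_div_add_mul (hab n hn)).const_mul _
  have h2 : Tendsto (fun ε : ℂ => ∑ n ∈ s, c n * (ε / (a n + b n * ε))) (𝓝[≠] 0) (𝓝 0) := by
    refine tendsto_const_nhds.congr' ?_
    filter_upwards [h] with ε hε
    rw [← mul_zero ε, ← hε, Finset.mul_sum]
    exact Finset.sum_congr rfl fun n _ => by ring
  rw [Finset.sum_filter]
  refine Eq.trans ?_ (tendsto_nhds_unique h1 h2)
  refine Finset.sum_congr rfl fun n _ => ?_
  split_ifs <;> simp [div_eq_mul_inv]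

variable [Fintype ι]

open Classical in
theorem double_pole_coefficient (a b : ι → ℂ) (g : ι → ι → ℂ) (hab : ∀ n, a n = 0 → b n = 1)
    (h : ∀ᶠ ε in 𝓝[≠] (0 : ℂ),
      ∑ n, ∑ m, g n m / ((a n + b n * ε) * (a m + b m * ε)) = 0) :
    ∑ n with a n = 0, ∑ m with a m = 0, g n m = 0 := by
  have hb (n : ι) : Tendsto (fun ε : ℂ => ε / (a n + b n * ε)) (𝓝[≠] 0)
      (𝓝 (if a n = 0 then 1 else 0)) := by
    have := tendsto_div_add_mul (a := a n) (b := b n) fun h0 => by simp [hab n h0]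
    split_ifs with h0
    · have hb1 := hab n h0
      simp only [if_pos h0, hb1, inv_one] at this ⊢
      exact this
    · rwa [if_neg h0] at this
  have h1 : Tendsto (fun ε : ℂ => ∑ n, ∑ m, g n m *
      ((ε / (a n + b n * ε)) * (ε / (a m + b m * ε)))) (𝓝[≠] 0)
      (𝓝 (∑ n, ∑ m, g n m * ((if a n = 0 then 1 else 0) * (if a m = 0 then 1 else 0)))) :=
    tendsto_finsetSum _ fun n _ => tendsto_finsetSum _ fun m _ =>
      ((hb n).mul (hb m)).const_mul _
  have h2 : Tendsto (fun ε : ℂ => ∑ n, ∑ m, g n m *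
      ((ε / (a n + b n * ε)) * (ε / (a m + b m * ε)))) (𝓝[≠] 0) (𝓝 0) := by
    refine tendsto_const_nhds.congr' ?_
    filter_upwards [h] with ε hε
    rw [← mul_zero (ε ^ 2), ← hε, Finset.mul_sum]
    refine Finset.sum_congr rfl fun n _ => ?_
    rw [Finset.mul_sum]
    exact Finset.sum_congr rfl fun m _ => by rw [div_mul_div_comm]; ring
  simp only [Finset.sum_filter]
  refine Eq.trans ?_ (tendsto_nhds_unique h1 h2)
  refine Finset.sum_congr rfl fun n _ => ?_
  split_ifs with h0
  · refine Finset.sum_congr rfl fun m _ => ?_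
    split_ifs <;> simp
  · simp

-- With no double pole left, multiplication by `ε` keeps exactly the pairs with one vanishing
-- constant term. By symmetry both orders of a pair contribute equally, and the resulting factor two
-- is cancelled.
open Classical in
theorem double_sum_simple_pole (a b : ι → ℂ) (g : ι → ι → ℂ) (hab : ∀ n, a n = 0 → b n = 1)
    (hg : ∀ n m, a n = 0 → a m = 0 → g n m = 0) (hsymm : ∀ n m, g n m = g m n)
    (h : ∀ᶠ ε in 𝓝[≠] (0 : ℂ),
      ∑ n, ∑ m, g n m / ((a n + b n * ε) * (a m + b m * ε)) = 0) :
    ∑ m with a m ≠ 0, (∑ n with a n = 0, g n m) / a m = 0 := by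
  let t : ι → ι → ℂ := fun n m => if a n = 0 ∧ a m ≠ 0 then g n m / a m else 0
  have ht (n m : ι) : Tendsto (fun ε : ℂ => ε * (g n m / ((a n + b n * ε) * (a m + b m * ε))))
      (𝓝[≠] 0) (𝓝 (t n m + t m n)) := by
    by_cases hn : a n = 0
    · by_cases hm : a m = 0
      · simp [t, hn, hm, hg n m hn hm]
      · have := ((tendsto_div_add_mul (a := a n) (b := b n) fun h0 => by simp [hab n h0]).mul
          (tendsto_inv_add_mul (b m) hm)).const_mul (g n m)
        rw [if_pos hn, hab n hn] at this
        convert this using 1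
        · funext ε
          rw [hab n hn, div_eq_mul_inv, div_eq_mul_inv, mul_inv]
          ring
        · simp [t, hn, hm, div_eq_mul_inv]
    · have := ((tendsto_div_add_mul (a := a m) (b := b m) fun h0 => by simp [hab m h0]).mul
          (tendsto_inv_add_mul (b n) hn)).const_mul (g n m)
      convert this using 1
      · funext ε
        rw [div_eq_mul_inv, div_eq_mul_inv, mul_inv]
        ring
      · by_cases hm : a m = 0
        · simp [t, hn, hm, hab m hm, hsymm m n, div_eq_mul_inv]
        · simp [t, hn, hm]
  have h1 : Tendsto (fun ε : ℂ => ∑ n, ∑ m, ε * (g n m / ((a n + b n * ε) * (a m + b m * ε))))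
      (𝓝[≠] 0) (𝓝 (∑ n, ∑ m, (t n m + t m n))) :=
    tendsto_finsetSum _ fun n _ => tendsto_finsetSum _ fun m _ => ht n m
  have h2 : Tendsto (fun ε : ℂ => ∑ n, ∑ m, ε * (g n m / ((a n + b n * ε) * (a m + b m * ε))))
      (𝓝[≠] 0) (𝓝 0) := by
    refine tendsto_const_nhds.congr' ?_
    filter_upwards [h] with ε hε
    rw [← mul_zero ε, ← hε, Finset.mul_sum]
    exact Finset.sum_congr rfl fun n _ => by rw [Finset.mul_sum]
  have h3 := tendsto_nhds_unique h1 h2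
  simp only [Finset.sum_add_distrib] at h3
  rw [Finset.sum_comm, ← two_mul] at h3
  have h4 := (mul_eq_zero.1 h3).resolve_left two_ne_zero
  rw [Finset.sum_filter]
  refine Eq.trans ?_ h4
  refine Finset.sum_congr rfl fun m _ => ?_
  by_cases hm : a m = 0
  · simp [t, hm]
  · simp [t, hm, Finset.sum_filter, Finset.sum_div, ite_div]

end Poles

/-! ### Residues along the plane `w₀ + w₁ + w₂ = 0`. -/

section Residues

open Filter Topology

variable {ι : Type*} [Fintype ι]

/-- This curve has `w₀ + w₁ + w₂ = ε`: it crosses the plane at `ε = 0`, at the point of the plane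
with parameter `τ`. -/
theorem linForm_pole_curve (ρ : Fin 3 → ℂ) (τ ε : ℂ) :
    linForm ρ ![ε - τ - 1, τ, 1] = ((ρ 1 - ρ 0) * τ + (ρ 2 - ρ 0)) + ρ 0 * ε := by
  simp [linForm, Fin.sum_univ_three]
  ring

/-- Ensures that the second residue, taken in `τ`, meets only simple poles. -/
theorem ratio_one_of_pole {ρ : Fin 3 → ℂ} (hsep : ρ 1 = ρ 0 → ρ 2 = ρ 0 → ρ = 1) (hρ : ρ ≠ 1)
    (τ : ℂ) (h : (ρ 1 - ρ 0) * τ + (ρ 2 - ρ 0) = 0) : ρ 1 - ρ 0 ≠ 0 := by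
  intro h0
  rw [h0, zero_mul, zero_add] at h
  exact hρ (hsep (sub_eq_zero.1 h0) (sub_eq_zero.1 h))

theorem eventually_no_pole (ρ : ι → Fin 3 → ℂ)
    (hsep : ∀ n, ρ n 1 = ρ n 0 → ρ n 2 = ρ n 0 → ρ n = 1) (τ : ℂ) :
    ∀ᶠ ε in 𝓝[≠] (0 : ℂ), ∀ n, (ρ n 1 - ρ n 0) * (τ + ε) + (ρ n 2 - ρ n 0) = 0 → ρ n = 1 := by
  rw [eventually_all]
  intro n
  by_cases hn : ρ n = 1
  · exact Eventually.of_forall fun _ _ => hn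
  · filter_upwards [eventually_add_mul_ne_zero (ratio_one_of_pole (hsep n) hn τ)] with ε hε h
    exact absurd (by linear_combination h) hε

theorem pole_iff {ρ : Fin 3 → ℂ} {τ : ℂ} (h : (ρ 1 - ρ 0) * τ + (ρ 2 - ρ 0) = 0 → ρ = 1) :
    (ρ 1 - ρ 0) * τ + (ρ 2 - ρ 0) = 0 ↔ ρ = 1 :=
  ⟨h, fun h => by simp [h]⟩

theorem eventually_double_sum (ρ : ι → Fin 3 → ℂ) (g : ι → ι → ℂ)
    (h : ∀ w, (∀ n, linForm (ρ n) w ≠ 0) →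
      ∑ n, ∑ m, g n m / (linForm (ρ n) w * linForm (ρ m) w) = 0)
    (τ : ℂ) (hτ : ∀ n, (ρ n 1 - ρ n 0) * τ + (ρ n 2 - ρ n 0) = 0 → ρ n = 1) :
    ∀ᶠ ε in 𝓝[≠] (0 : ℂ), ∑ n, ∑ m, g n m /
      ((((ρ n 1 - ρ n 0) * τ + (ρ n 2 - ρ n 0)) + ρ n 0 * ε) *
        (((ρ m 1 - ρ m 0) * τ + (ρ m 2 - ρ m 0)) + ρ m 0 * ε)) = 0 := by
  have : ∀ᶠ ε in 𝓝[≠] (0 : ℂ), ∀ n,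
      ((ρ n 1 - ρ n 0) * τ + (ρ n 2 - ρ n 0)) + ρ n 0 * ε ≠ 0 :=
    eventually_all.2 fun n => eventually_add_mul_ne_zero fun h0 => by simp [hτ n h0]
  filter_upwards [this] with ε hε
  have := h ![ε - τ - 1, τ, 1]
  simp only [linForm_pole_curve] at this
  exact this hε

open Classical in
/-- The coefficient of the double pole along `w₀ + w₁ + w₂ = 0`. -/
theorem double_pole_sum_eq_zero (ρ : ι → Fin 3 → ℂ)
    (hsep : ∀ n, ρ n 1 = ρ n 0 → ρ n 2 = ρ n 0 → ρ n = 1) (g : ι → ι → ℂ)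
    (h : ∀ w, (∀ n, linForm (ρ n) w ≠ 0) →
      ∑ n, ∑ m, g n m / (linForm (ρ n) w * linForm (ρ m) w) = 0) :
    ∑ n with ρ n = 1, ∑ m with ρ m = 1, g n m = 0 := by
  obtain ⟨ε, hε⟩ := (eventually_no_pole ρ hsep 0).exists
  have := double_pole_coefficient _ _ g (fun n h0 => by simp [hε n h0])
    (eventually_double_sum ρ g h (0 + ε) hε)
  simpa only [pole_iff (hε _)] using this

open Classical in
/-- The residues, along `w₀ + w₁ + w₂ = 0`, of the coefficient of the simple pole. -/
theorem iterated_residue_eq_zero (ρ : ι → Fin 3 → ℂ)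
    (hsep : ∀ n, ρ n 1 = ρ n 0 → ρ n 2 = ρ n 0 → ρ n = 1) (g : ι → ι → ℂ)
    (h : ∀ w, (∀ n, linForm (ρ n) w ≠ 0) →
      ∑ n, ∑ m, g n m / (linForm (ρ n) w * linForm (ρ m) w) = 0)
    (hg : ∀ n m, ρ n = 1 → ρ m = 1 → g n m = 0) (hsymm : ∀ n m, g n m = g m n) (τ : ℂ) :
    ∑ m with ρ m ≠ 1 ∧ (ρ m 1 - ρ m 0) * τ + (ρ m 2 - ρ m 0) = 0,
      (∑ n with ρ n = 1, g n m) / (ρ m 1 - ρ m 0) = 0 := by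
  rw [← Finset.filter_filter]
  refine simple_pole_residue _ (fun m => (ρ m 1 - ρ m 0) * τ + (ρ m 2 - ρ m 0)) _ _
    (fun m hm => ratio_one_of_pole (hsep m) (Finset.mem_filter.1 hm).2 τ) ?_
  -- Here `ε` displaces `τ` inside the plane; at such generic parameters only the forms with `ρ n =
  -- 1` vanish.
  filter_upwards [eventually_no_pole ρ hsep τ] with ε hε
  have := double_sum_simple_pole _ _ g (fun n h0 => by simp [hε n h0])
    (fun n m hn hm => hg n m (hε n hn) (hε m hm)) hsymm
    (eventually_double_sum ρ g h (τ + ε) hε)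
  simp only [ne_eq, pole_iff (hε _)] at this
  rw [← this]
  refine Finset.sum_congr rfl fun m _ => ?_
  congr 1
  ring

end Residues

/-! ### Rigidity of triples of unimodular numbers. -/

section RootsOfUnity

theorem eq_one_of_pow_eq_one_of_coprime {x : ℂ} {a b : ℕ} (hab : a.Coprime b)
    (ha : x ^ a = 1) (hb : x ^ b = 1) : x = 1 := by
  have h := Nat.dvd_gcd (orderOf_dvd_of_pow_eq_one ha) (orderOf_dvd_of_pow_eq_one hb)
  rw [hab.gcd_eq_one, Nat.dvd_one, orderOf_eq_one_iff] at h
  exact h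

/-- On the unit circle conjugation is inversion. Dividing `h` by its conjugate leaves `x 1 * y 2 = x
2 * y 1`, and substitution into `h` gives the remaining ratio. -/
theorem ratio_eq_of_cross_ratio_eq {x y : Fin 3 → ℂ} (hx : ∀ i, ‖x i‖ = 1) (hy : ∀ i, ‖y i‖ = 1)
    (h20 : x 2 ≠ x 0) (h12 : x 1 ≠ x 2) (hy10 : y 1 ≠ y 0)
    (h : (x 1 - x 0) * (y 2 - y 0) = (x 2 - x 0) * (y 1 - y 0)) (i : Fin 3) :
    y i * x 1 = x i * y 1 := by
  have hx0 (i) : x i ≠ 0 := fun h0 => by simpa [h0] using hx i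
  have hy0 (i) : y i ≠ 0 := fun h0 => by simpa [h0] using hy i
  have hc := congrArg (starRingEnd ℂ) h
  simp only [map_mul, map_sub, ← Complex.inv_eq_conj (hx _), ← Complex.inv_eq_conj (hy _)] at hc
  have e1 : ((x 1)⁻¹ - (x 0)⁻¹) * ((y 2)⁻¹ - (y 0)⁻¹) * (x 0 * x 1 * x 2 * y 0 * y 1 * y 2) =
      ((x 1 - x 0) * (y 2 - y 0)) * (x 2 * y 1) := by
    have := hx0 0; have := hx0 1; have := hy0 0; have := hy0 2
    field_simp
    ring
  have e2 : ((x 2)⁻¹ - (x 0)⁻¹) * ((y 1)⁻¹ - (y 0)⁻¹) * (x 0 * x 1 * x 2 * y 0 * y 1 * y 2) =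
      ((x 1 - x 0) * (y 2 - y 0)) * (x 1 * y 2) := by
    rw [h]
    have := hx0 0; have := hx0 2; have := hy0 0; have := hy0 1
    field_simp
    ring
  have hne : (x 1 - x 0) * (y 2 - y 0) ≠ 0 := by
    rw [h]
    exact mul_ne_zero (sub_ne_zero.2 h20) (sub_ne_zero.2 hy10)
  have h2 : y 2 * x 1 = x 2 * y 1 := by
    refine mul_left_cancel₀ hne ?_
    linear_combination e1 - e2 - (x 0 * x 1 * x 2 * y 0 * y 1 * y 2) * hc
  have h0 : y 0 * x 1 = x 0 * y 1 := by
    refine mul_left_cancel₀ (sub_ne_zero.2 h12) ?_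
    linear_combination (-x 1) * h + (x 1 - x 0) * h2
  fin_cases i
  · exact h0
  · exact mul_comm _ _
  · exact h2

end RootsOfUnity

/-! ### Positivity and vanishing of the coefficients. -/

section Vanishing

variable {ι : Type*} {q : Fin 3 → ℕ} {ρ : ι → Fin 3 → ℂ}

theorem roots_separated (hcop : ∀ i j, i ≠ j → (q i).Coprime (q j))
    (hρ : ∀ n i, ρ n i ^ q i = 1) {n : ι} {i j : Fin 3} (hij : i ≠ j) (h : ρ n i = ρ n j) :
    ρ n i = 1 ∧ ρ n j = 1 := by
  have : ρ n i = 1 := eq_one_of_pow_eq_one_of_coprime (hcop i j hij) (hρ n i) (h ▸ hρ n j)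
  exact ⟨this, h ▸ this⟩

theorem roots_separated_triple (hcop : ∀ i j, i ≠ j → (q i).Coprime (q j))
    (hρ : ∀ n i, ρ n i ^ q i = 1) (n : ι) (h1 : ρ n 1 = ρ n 0) (h2 : ρ n 2 = ρ n 0) :
    ρ n = 1 := by
  obtain ⟨ha, hb⟩ := roots_separated hcop hρ (by decide) h1
  funext i
  fin_cases i
  · exact hb
  · exact ha
  · exact h2.trans hb

theorem re_inv_sub_one {y : ℂ} (hy : ‖y‖ = 1) (h1 : y ≠ 1) : ((y - 1)⁻¹).re = -(1 / 2) := by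
  have hy0 : y ≠ 0 := by rintro rfl; simp at hy
  have h2 : y - 1 ≠ 0 := sub_ne_zero.2 h1
  have h3 : y⁻¹ - 1 ≠ 0 := fun h => h1 (by simpa using sub_eq_zero.1 h)
  have h4 : (y - 1)⁻¹ + (starRingEnd ℂ) ((y - 1)⁻¹) = -1 := by
    rw [map_inv₀, map_sub, map_one, ← Complex.inv_eq_conj hy]
    have h5 : 1 - y ≠ 0 := sub_ne_zero.2 (Ne.symm h1)
    have h6 : (y⁻¹ - 1) = (1 - y) / y := by field_simp
    rw [h6]
    field_simp
    ring
  rw [Complex.add_conj] at h4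
  have := congrArg Complex.re h4
  simp only [Complex.ofReal_re, Complex.neg_re, Complex.one_re] at this
  linarith

variable [Fintype ι]

open Classical in
theorem eq_zero_of_residues (hq : ∀ i, 0 < q i) (hcop : ∀ i j, i ≠ j → (q i).Coprime (q j))
    (hρ : ∀ n i, ρ n i ^ q i = 1) (c : ι → ℝ) (hc : ∀ m, 0 ≤ c m)
    (h : ∀ τ : ℂ, ∑ m with ρ m ≠ 1 ∧ (ρ m 1 - ρ m 0) * τ + (ρ m 2 - ρ m 0) = 0,
      (c m : ℂ) / (ρ m 1 - ρ m 0) = 0) {m : ι} (hm : ρ m 1 ≠ 1) : c m = 0 := by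
  have hnorm (n : ι) (i : Fin 3) : ‖ρ n i‖ = 1 :=
    Complex.norm_eq_one_of_pow_eq_one (hρ n i) (hq i).ne'
  have hm1 : ρ m ≠ 1 := fun h1 => hm (by rw [h1]; rfl)
  have h10 : ρ m 1 ≠ ρ m 0 := fun h1 => hm (roots_separated hcop hρ (by decide) h1).1
  -- Degenerate pole `τ = 0`: its forms have `ρ k 0 = ρ k 2 = 1` but possibly different `ρ k 1`. The
  -- weights `(ρ k 1 - 1)⁻¹` may differ, yet all have real part `-1/2`.
  by_cases hB : ρ m 2 = ρ m 0
  · have hsum := h 0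
    have hterm : ∀ k ∈ Finset.univ.filter (fun m => ρ m ≠ 1 ∧
        (ρ m 1 - ρ m 0) * 0 + (ρ m 2 - ρ m 0) = 0),
        ((c k : ℂ) / (ρ k 1 - ρ k 0)).re = -(1 / 2) * c k := by
      intro k hk
      obtain ⟨hk1, hk2⟩ := (Finset.mem_filter.1 hk).2
      rw [mul_zero, zero_add, sub_eq_zero] at hk2
      have hk0 := (roots_separated hcop hρ (by decide) hk2).2
      have hk3 : ρ k 1 ≠ 1 := fun h1 =>
        hk1 (roots_separated_triple hcop hρ k (h1.trans hk0.symm) hk2)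
      rw [hk0, div_eq_mul_inv, Complex.re_ofReal_mul, re_inv_sub_one (hnorm k 1) hk3, mul_comm]
    have hre := congrArg Complex.re hsum
    rw [Complex.re_sum, Finset.sum_congr rfl hterm, ← Finset.mul_sum, Complex.zero_re] at hre
    have hz := (mul_eq_zero.1 hre).resolve_left (by norm_num)
    exact (Finset.sum_eq_zero_iff_of_nonneg fun k _ => hc k).1 hz m (by simp [hm1, hB])
  -- At any other pole, all the forms involved have the same `ρ k 0` and `ρ k 1`, hence the same
  -- weight.
  · have h12 : ρ m 1 ≠ ρ m 2 := fun h1 => hm (roots_separated hcop hρ (by decide) h1).1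
    have hp : ρ m 1 - ρ m 0 ≠ 0 := sub_ne_zero.2 h10
    set τ : ℂ := -(ρ m 2 - ρ m 0) / (ρ m 1 - ρ m 0) with hτ
    have hτm : (ρ m 1 - ρ m 0) * τ = -(ρ m 2 - ρ m 0) := mul_div_cancel₀ _ hp
    have hsum := h τ
    have hterm : ∀ k ∈ Finset.univ.filter (fun k => ρ k ≠ 1 ∧
        (ρ k 1 - ρ k 0) * τ + (ρ k 2 - ρ k 0) = 0),
        (c k : ℂ) / (ρ k 1 - ρ k 0) = (ρ m 1 - ρ m 0)⁻¹ * (c k : ℂ) := by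
      intro k hk
      obtain ⟨hk1, hk2⟩ := (Finset.mem_filter.1 hk).2
      have hkp := ratio_one_of_pole (roots_separated_triple hcop hρ k) hk1 τ hk2
      have hcross : (ρ m 1 - ρ m 0) * (ρ k 2 - ρ k 0) = (ρ m 2 - ρ m 0) * (ρ k 1 - ρ k 0) := by
        linear_combination (ρ m 1 - ρ m 0) * hk2 - (ρ k 1 - ρ k 0) * hτm
      have hrat := ratio_eq_of_cross_ratio_eq (hnorm m) (hnorm k) hB h12 (sub_ne_zero.1 hkp) hcross
      have hne (i) : ρ m i ≠ 0 := fun h0 => by simpa [h0] using hnorm m i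
      -- This ratio equals `ρ k 2 / ρ m 2`, so its order divides both `q 1` and `q 2`.
      have hα : ρ k 1 / ρ m 1 = 1 := by
        refine eq_one_of_pow_eq_one_of_coprime (hcop 1 2 (by decide)) ?_ ?_
        · rw [div_pow, hρ, hρ, div_one]
        · rw [(div_eq_div_iff (hne 1) (hne 2)).2 (by rw [mul_comm, ← hrat 2]),
            div_pow, hρ, hρ, div_one]
      have hk1' : ρ k 1 = ρ m 1 := (div_eq_one_iff_eq (hne 1)).1 hα
      have hk0 : ρ k 0 = ρ m 0 := by
        have := hrat 0
        rw [hk1'] at this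
        exact mul_right_cancel₀ (hne 1) this
      rw [hk1', hk0, div_eq_mul_inv, mul_comm]
    rw [Finset.sum_congr rfl hterm, ← Finset.mul_sum, ← Complex.ofReal_sum] at hsum
    have hz := Complex.ofReal_eq_zero.1 ((mul_eq_zero.1 hsum).resolve_left (inv_ne_zero hp))
    exact (Finset.sum_eq_zero_iff_of_nonneg fun k _ => hc k).1 hz m
      (Finset.mem_filter.2 ⟨Finset.mem_univ m, hm1, by rw [hτm]; ring⟩)

theorem linForm_perm (σ : Equiv.Perm (Fin 3)) (r w : Fin 3 → ℂ) :
    linForm (r ∘ σ) w = linForm r (w ∘ σ.symm) := by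
  unfold linForm
  rw [← Equiv.sum_comp σ fun i => r i * (w ∘ σ.symm) i]
  simp

/-- Nonnegative symmetric coefficients `g` with `∑ g n m / (L_n L_m) = 0` vanish at every index whose
form is `w₀ + w₁ + w₂`. -/
theorem coefficients_eq_zero (hq : ∀ i, 0 < q i) (hcop : ∀ i j, i ≠ j → (q i).Coprime (q j))
    (hρ : ∀ n i, ρ n i ^ q i = 1) (g : ι → ι → ℝ) (hg : ∀ n m, 0 ≤ g n m)
    (hsymm : ∀ n m, g n m = g m n)
    (h : ∀ w, (∀ n, linForm (ρ n) w ≠ 0) →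
      ∑ n, ∑ m, (g n m : ℂ) / (linForm (ρ n) w * linForm (ρ m) w) = 0)
    {n₀ : ι} (hn₀ : ρ n₀ = 1) (m : ι) : g n₀ m = 0 := by
  classical
  have hsep := roots_separated_triple hcop hρ
  have hdiag : ∀ n m, ρ n = 1 → ρ m = 1 → g n m = 0 := by
    intro n m hn hm
    have h1 := double_pole_sum_eq_zero ρ hsep (fun n m => (g n m : ℂ)) h
    have h2 : ∑ n with ρ n = 1, ∑ m with ρ m = 1, g n m = 0 := by exact_mod_cast h1
    have h3 := (Finset.sum_eq_zero_iff_of_nonneg fun n _ =>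
      Finset.sum_nonneg fun m _ => hg n m).1 h2 n (by simp [hn])
    exact (Finset.sum_eq_zero_iff_of_nonneg fun m _ => hg n m).1 h3 m (by simp [hm])
  by_cases hm : ρ m = 1
  · exact hdiag n₀ m hn₀ hm
  · obtain ⟨i, hi⟩ := Function.ne_iff.1 hm
    -- The residue argument needs the nontrivial root in slot `1`; the swap moves it there.
    let σ : Equiv.Perm (Fin 3) := Equiv.swap 1 i
    have hσ1 : σ 1 = i := Equiv.swap_apply_left 1 i
    have hone (n : ι) : ρ n ∘ σ = 1 ↔ ρ n = 1 := by
      constructor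
      · intro h1
        have := congrArg (· ∘ σ.symm) h1
        simpa [Function.comp_assoc] using this
      · intro h1
        rw [h1]
        rfl
    have hcop' : ∀ i j, i ≠ j → ((q ∘ σ) i).Coprime ((q ∘ σ) j) := fun i j hij =>
      hcop _ _ fun h1 => hij (σ.injective h1)
    have hρ' : ∀ n i, (ρ n ∘ σ) i ^ (q ∘ σ) i = 1 := fun n i => hρ n _
    have hres := iterated_residue_eq_zero (fun n => ρ n ∘ σ) (roots_separated_triple hcop' hρ')
      (fun n m => (g n m : ℂ)) (fun w hw => by
        simp only [linForm_perm] at hw ⊢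
        exact h _ hw)
      (fun n m hn hm => by rw [hdiag n m ((hone n).1 hn) ((hone m).1 hm), Complex.ofReal_zero])
      (fun n m => by rw [hsymm n m])
    have hz := eq_zero_of_residues (ρ := fun n => ρ n ∘ σ) (fun i => hq _) hcop' hρ'
      (fun m => ∑ n with ρ n ∘ σ = 1, g n m) (fun m => Finset.sum_nonneg fun n _ => hg n m)
      (fun τ => by simpa only [Complex.ofReal_sum] using hres τ) (m := m)
      (by simpa [hσ1] using hi)
    exact (Finset.sum_eq_zero_iff_of_nonneg fun n _ => hg n m).1 hz n₀ (by simp [hone, hn₀])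

/-- A matrix which is Hermitian off the diagonal and constant on it, and whose Floquet determinant
is that of a constant potential `μ`, has vanishing off-diagonal entries in the row of
`w₀ + w₁ + w₂`, and its diagonal entries equal `μ`. -/
theorem row_eq_of_floquet_det_eq [DecidableEq ι] (hq : ∀ i, 0 < q i)
    (hcop : ∀ i j, i ≠ j → (q i).Coprime (q j)) (hρ : ∀ n i, ρ n i ^ q i = 1)
    (K : Matrix ι ι ℂ) (κ μ : ℂ) (c : ι → ℂ) (hdiag : ∀ n, K n n = κ)
    (hherm : ∀ n m, n ≠ m → K m n = (starRingEnd ℂ) (K n m))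
    (h : ∀ z : Fin 3 → ℂ, (∀ i, ‖z i‖ = 1) →
      (Matrix.diagonal (fun n => ∑ i, (ρ n i * z i + (ρ n i * z i)⁻¹)) +
        (Matrix.diagonal c + K)).det =
      (Matrix.diagonal (fun n => ∑ i, (ρ n i * z i + (ρ n i * z i)⁻¹)) +
        Matrix.diagonal fun n => c n + μ).det)
    {n₀ : ι} (hn₀ : ρ n₀ = 1) : κ = μ ∧ ∀ m, m ≠ n₀ → K n₀ m = 0 := by
  have htr := trace_eq_of_floquet_det_eq ρ _ _ h
  have hρ0 (n : ι) : ρ n ≠ 0 := fun h0 => by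
    have := hρ n 0
    rw [h0, Pi.zero_apply, zero_pow (hq 0).ne'] at this
    exact zero_ne_one this
  have hsep := roots_separated_triple hcop hρ
  have hκ : κ = μ := by
    classical
    -- Squaring the single sum `∑ (κ - μ) / L_n = 0` lets the double-sum lemmas serve for it too.
    have h1 := double_sum_eq_zero_of_torus ρ hρ0 (fun _ _ => (κ - μ) ^ 2) fun w hw hL => by
      have h2 := (htr w hw hL).1
      rw [← sub_eq_zero, ← Finset.sum_sub_distrib] at h2
      have h3 : ∑ n, (κ - μ) / linForm (ρ n) w = 0 := by
        rw [← h2]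
        refine Finset.sum_congr rfl fun n _ => ?_
        rw [Matrix.add_apply, Matrix.diagonal_apply_eq, Matrix.diagonal_apply_eq, hdiag, ← sub_div]
        ring
      refine Eq.trans ?_ (mul_eq_zero_of_left h3 (∑ n, (κ - μ) / linForm (ρ n) w))
      rw [Finset.sum_mul_sum]
      refine Finset.sum_congr rfl fun n _ => Finset.sum_congr rfl fun m _ => ?_
      rw [div_mul_div_comm, sq]
    have h4 := double_pole_sum_eq_zero ρ hsep _ h1
    have hcard : (Finset.univ.filter fun n => ρ n = 1).card ≠ 0 :=
      Finset.card_ne_zero_of_mem (Finset.mem_filter.2 ⟨Finset.mem_univ n₀, hn₀⟩)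
    simp only [Finset.sum_const, nsmul_eq_mul, mul_eq_zero, Nat.cast_eq_zero, hcard,
      false_or] at h4
    exact sub_eq_zero.1 (pow_eq_zero_iff two_ne_zero |>.1 h4)
  refine ⟨hκ, fun m hm => ?_⟩
  -- Since `κ = μ`, the diagonal terms of the two traces cancel.
  let g : ι → ι → ℝ := fun n m => if n = m then 0 else Complex.normSq (K n m)
  have hg := coefficients_eq_zero hq hcop hρ g
    (fun n m => by
      simp only [g]
      split_ifs
      exacts [le_rfl, Complex.normSq_nonneg _])
    (fun n m => by
      simp only [g, eq_comm (a := m)]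
      split_ifs with hnm
      · rfl
      · rw [hherm n m hnm, Complex.normSq_conj])
    (double_sum_eq_zero_of_torus ρ hρ0 (fun n m => (g n m : ℂ)) fun w hw hL => by
      have h2 := (htr w hw hL).2
      rw [← sub_eq_zero, ← Finset.sum_sub_distrib] at h2
      rw [← h2]
      refine Finset.sum_congr rfl fun n _ => ?_
      rw [← Finset.sum_sub_distrib]
      refine Finset.sum_congr rfl fun m _ => ?_
      rw [← sub_div]
      congr 1
      by_cases hnm : n = m
      · subst hnm
        simp [g, hdiag, hκ]
      · simp [g, hnm, Ne.symm hnm, hherm n m hnm, Complex.mul_conj])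
    hn₀ m
  simpa [g, Ne.symm hm] using hg

end Vanishing

/-! ### The Floquet matrix in the plane-wave basis. -/

noncomputable section

namespace PeriodicSchrodinger

open Matrix

variable {d : ℕ} {q : Fin d → ℕ}

theorem IsFloquet.eq_zero {k : Fin d → ℂ} {u : (Fin d → ℤ) → ℂ} (hq : ∀ j, 0 < q j)
    (hu : IsFloquet q k u) (h : ∀ n : Cell q, u (cellPoint n) = 0) (m : Fin d → ℤ) : u m = 0 := by
  -- Translations preserving the zero set of `u` form a group, so the generators of `Γ` suffice.
  let H : AddSubgroup (Fin d → ℤ) :=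
    { carrier := {γ | ∀ m, u (m + γ) = 0 ↔ u m = 0}
      zero_mem' := fun m => by rw [add_zero]
      add_mem' := fun {a b} ha hb m => by rw [← add_assoc, hb, ha]
      neg_mem' := fun {a} ha m => by rw [← ha (m + -a), neg_add_cancel_right] }
  have hH (j : Fin d) : (Pi.single j (q j : ℤ) : Fin d → ℤ) ∈ H := fun m => by
    rw [hu m j, mul_eq_zero, or_iff_right (Complex.exp_ne_zero _)]
  let n : Cell q := fun j => ⟨(m j % q j).toNat, by
    have h1 := Int.emod_lt_of_pos (m j) (Int.natCast_pos.2 (hq j))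
    have h2 := Int.emod_nonneg (m j) (Int.natCast_pos.2 (hq j)).ne'
    omega⟩
  have hn : m = cellPoint n + ∑ j, (m j / q j) • (Pi.single j (q j : ℤ) : Fin d → ℤ) := by
    funext i
    have h2 := Int.emod_nonneg (m i) (Int.natCast_pos.2 (hq i)).ne'
    simp only [Pi.add_apply, Finset.sum_apply, Pi.smul_apply, Pi.single_apply, smul_eq_mul,
      mul_ite, mul_zero, Finset.sum_ite_eq, Finset.mem_univ, if_true, cellPoint, n,
      Int.toNat_of_nonneg h2]
    rw [mul_comm, Int.emod_add_mul_ediv]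
  have hmem : ∑ j, (m j / q j) • (Pi.single j (q j : ℤ) : Fin d → ℤ) ∈ H :=
    H.sum_mem fun j _ => H.zsmul_mem (hH j) _
  rw [hn]
  exact (hmem _).2 (h n)

theorem IsFloquet.eq_sum {k : Fin d → ℂ} {u : (Fin d → ℤ) → ℂ} (hq : ∀ j, 0 < q j)
    (hu : IsFloquet q k u) (m : Fin d → ℤ) :
    u m = ∑ n : Cell q, u (cellPoint n) * floquetBasis q k n m := by
  have hF : IsFloquet q k fun m => u m - ∑ n : Cell q, u (cellPoint n) * floquetBasis q k n m := by
    intro m j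
    simp only [hu m j, fun n : Cell q => floquetBasis_isFloquet q hq k n m j]
    rw [mul_sub, Finset.mul_sum]
    congr 1
    exact Finset.sum_congr rfl fun n _ => by ring
  refine sub_eq_zero.1 (hF.eq_zero hq (fun n => ?_) m)
  simp [floquetBasis_cellPoint]

theorem schrodinger_sum {ι : Type*} (s : Finset ι) (V : (Fin d → ℤ) → ℂ) (c : ι → ℂ)
    (f : ι → (Fin d → ℤ) → ℂ) (n : Fin d → ℤ) :
    schrodinger V (fun m => ∑ i ∈ s, c i * f i m) n = ∑ i ∈ s, schrodinger V (f i) n * c i := by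
  simp only [schrodinger, laplacian, add_mul, Finset.sum_add_distrib, Finset.sum_mul,
    Finset.mul_sum]
  rw [Finset.sum_comm (s := Finset.univ), Finset.sum_comm (s := Finset.univ)]
  refine congrArg₂ _ (congrArg₂ _ ?_ ?_) ?_ <;> refine Finset.sum_congr rfl fun i _ => ?_
  · exact Finset.sum_congr rfl fun j _ => mul_comm _ _
  · exact Finset.sum_congr rfl fun j _ => mul_comm _ _
  · ring

theorem floquetMatrix_mulVec {k : Fin d → ℂ} {u : (Fin d → ℤ) → ℂ} (hq : ∀ j, 0 < q j)
    (hu : IsFloquet q k u) (V : (Fin d → ℤ) → ℂ) (x : Cell q) :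
    ∑ n, floquetMatrix q V k x n * u (cellPoint n) = schrodinger V u (cellPoint x) := by
  conv_rhs => rw [funext (hu.eq_sum hq)]
  rw [schrodinger_sum]
  rfl

/-- The plane wave `m ↦ ∏ ζ_j ^ m_j`. -/
def planeWave (ζ : Fin d → ℂ) (m : Fin d → ℤ) : ℂ := ∏ j, ζ j ^ m j

theorem planeWave_add_single {ζ : Fin d → ℂ} (hζ : ∀ j, ζ j ≠ 0) (m : Fin d → ℤ) (j : Fin d)
    (a : ℤ) : planeWave ζ (m + Pi.single j a) = ζ j ^ a * planeWave ζ m := by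
  simp only [planeWave, Pi.add_apply, zpow_add₀ (hζ _), Finset.prod_mul_distrib]
  rw [mul_comm]
  congr 1
  rw [Finset.prod_eq_single j]
  · simp
  · intro i _ hi
    simp [hi]
  · simp

theorem laplacian_planeWave {ζ : Fin d → ℂ} (hζ : ∀ j, ζ j ≠ 0) (m : Fin d → ℤ) :
    laplacian (planeWave ζ) m = (∑ j, (ζ j + (ζ j)⁻¹)) * planeWave ζ m := by
  rw [laplacian, Finset.sum_mul]
  refine Finset.sum_congr rfl fun j _ => ?_
  rw [sub_eq_add_neg, ← Pi.single_neg, planeWave_add_single hζ, planeWave_add_single hζ, zpow_one,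
    _root_.zpow_neg_one, add_mul]

/-- The root of unity `e^{2πi n_j / q_j}`. -/
def cellRoot (n : Cell q) (j : Fin d) : ℂ :=
  Complex.exp (2 * Real.pi * Complex.I / q j) ^ (n j : ℕ)

theorem cellRoot_pow (hq : ∀ j, 0 < q j) (n : Cell q) (j : Fin d) : cellRoot n j ^ q j = 1 := by
  rw [cellRoot, ← pow_mul, mul_comm (n j : ℕ), pow_mul,
    (Complex.isPrimitiveRoot_exp (q j) (hq j).ne').pow_eq_one, one_pow]

theorem norm_cellRoot (hq : ∀ j, 0 < q j) (n : Cell q) (j : Fin d) : ‖cellRoot n j‖ = 1 :=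
  Complex.norm_eq_one_of_pow_eq_one (cellRoot_pow hq n j) (hq j).ne'

theorem cellRoot_ne_zero (n : Cell q) (j : Fin d) : cellRoot n j ≠ 0 :=
  pow_ne_zero _ (Complex.exp_ne_zero _)

theorem cellRoot_injective (hq : ∀ j, 0 < q j) {n m : Cell q} (h : cellRoot n = cellRoot m) :
    n = m := by
  funext j
  exact Fin.ext ((Complex.isPrimitiveRoot_exp (q j) (hq j).ne').pow_inj (n j).2 (m j).2
    (congrFun h j))

variable (q) in
/-- The discrete Fourier matrix of the cell. -/
def fourierMatrix : Matrix (Cell q) (Cell q) ℂ :=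
  Matrix.of fun x n => ∏ j, cellRoot n j ^ (x j : ℕ)

theorem fourierMatrix_conjTranspose_mul_apply (hq : ∀ j, 0 < q j) (n m : Cell q) :
    ∑ x, (starRingEnd ℂ) (fourierMatrix q x n) * fourierMatrix q x m =
      if n = m then ((∏ j, q j : ℕ) : ℂ) else 0 := by
  have h1 : ∑ x, (starRingEnd ℂ) (fourierMatrix q x n) * fourierMatrix q x m =
      ∏ j, ∑ a : Fin (q j), ((cellRoot n j)⁻¹ * cellRoot m j) ^ (a : ℕ) := by
    rw [Fintype.prod_sum]
    refine Finset.sum_congr rfl fun x _ => ?_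
    simp only [fourierMatrix, of_apply, map_prod, map_pow, ← Finset.prod_mul_distrib,
      ← Complex.inv_eq_conj (norm_cellRoot hq n _), mul_pow]
  rw [h1]
  split_ifs with h
  · subst h
    rw [Nat.cast_prod]
    refine Finset.prod_congr rfl fun j _ => ?_
    simp [inv_mul_cancel₀ (cellRoot_ne_zero n j)]
  · obtain ⟨j, hj⟩ := Function.ne_iff.1 (mt (cellRoot_injective hq) h)
    refine Finset.prod_eq_zero (Finset.mem_univ j) ?_
    have hne : (cellRoot n j)⁻¹ * cellRoot m j - 1 ≠ 0 := by
      rw [sub_ne_zero, ne_eq, inv_mul_eq_one₀ (cellRoot_ne_zero n j)]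
      exact hj
    rw [Fin.sum_univ_eq_sum_range fun a => ((cellRoot n j)⁻¹ * cellRoot m j) ^ a]
    refine (mul_eq_zero.1 ?_).resolve_right hne
    rw [geom_sum_mul, mul_pow, inv_pow, cellRoot_pow hq, cellRoot_pow hq, inv_one, mul_one,
      sub_self]

theorem cellCard_ne_zero (hq : ∀ j, 0 < q j) : ((∏ j, q j : ℕ) : ℂ) ≠ 0 :=
  Nat.cast_ne_zero.2 (Finset.prod_pos fun j _ => hq j).ne'

theorem inv_smul_conjTranspose_mul_fourierMatrix (hq : ∀ j, 0 < q j) :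
    (((∏ j, q j : ℕ) : ℂ)⁻¹ • (fourierMatrix q)ᴴ) * fourierMatrix q = 1 := by
  ext n m
  rw [Matrix.smul_mul, Matrix.smul_apply, Matrix.mul_apply]
  have := fourierMatrix_conjTranspose_mul_apply hq n m
  simp only [conjTranspose_apply, ← starRingEnd_apply, this, smul_eq_mul, Matrix.one_apply]
  split_ifs
  · exact inv_mul_cancel₀ (cellCard_ne_zero hq)
  · rw [mul_zero]

variable (q) in
/-- The potential in the Fourier basis. -/
def fourierPotential (V : (Fin d → ℤ) → ℂ) : Matrix (Cell q) (Cell q) ℂ :=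
  (((∏ j, q j : ℕ) : ℂ)⁻¹ • (fourierMatrix q)ᴴ) * diagonal (fun x => V (cellPoint x)) *
    fourierMatrix q

theorem fourierPotential_const (hq : ∀ j, 0 < q j) (c : ℂ) :
    fourierPotential q (fun _ => c) = c • (1 : Matrix (Cell q) (Cell q) ℂ) := by
  have : (diagonal fun _ : Cell q => c) = c • (1 : Matrix (Cell q) (Cell q) ℂ) := by
    rw [smul_one_eq_diagonal]
  rw [fourierPotential, this, Matrix.mul_smul, Matrix.smul_mul, mul_one,
    inv_smul_conjTranspose_mul_fourierMatrix hq]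

theorem fourierPotential_apply (V : (Fin d → ℤ) → ℂ) (n m : Cell q) :
    fourierPotential q V n m = ((∏ j, q j : ℕ) : ℂ)⁻¹ * ∑ x, (starRingEnd ℂ) (fourierMatrix q x n) *
      V (cellPoint x) * fourierMatrix q x m := by
  rw [fourierPotential, Matrix.mul_apply, Finset.mul_sum]
  refine Finset.sum_congr rfl fun x _ => ?_
  rw [mul_diagonal, Matrix.smul_apply, conjTranspose_apply, smul_eq_mul, starRingEnd_apply]
  ring

/-- The dispersion polynomial computed in the basis of plane waves. -/
theorem dispersion_eq (hq : ∀ j, 0 < q j) (V : (Fin d → ℤ) → ℂ) (k z : Fin d → ℂ)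
    (hz0 : ∀ j, z j ≠ 0) (hz : ∀ j, z j ^ q j = Complex.exp (2 * Real.pi * Complex.I * k j))
    (lam : ℂ) :
    dispersion q V k lam =
      (diagonal (fun n : Cell q => ∑ j, (cellRoot n j * z j + (cellRoot n j * z j)⁻¹)) +
        (fourierPotential q V - lam • (1 : Matrix (Cell q) (Cell q) ℂ))).det := by
  let ζ : Cell q → Fin d → ℂ := fun n j => cellRoot n j * z j
  have hζ (n j) : ζ n j ≠ 0 := mul_ne_zero (cellRoot_ne_zero n j) (hz0 j)
  let a : Cell q → ℂ := fun n => ∑ j, (ζ n j + (ζ n j)⁻¹)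
  let G : Cell q → ℂ := fun x => ∏ j, z j ^ (x j : ℕ)
  let E : Matrix (Cell q) (Cell q) ℂ := diagonal G * fourierMatrix q
  have hE (x n) : E x n = planeWave (ζ n) (cellPoint x) := by
    simp only [E, diagonal_mul, G, fourierMatrix, of_apply, planeWave, cellPoint, zpow_natCast,
      ← Finset.prod_mul_distrib, ζ, mul_pow]
    exact Finset.prod_congr rfl fun j _ => mul_comm _ _
  have hfl (n) : IsFloquet q k (planeWave (ζ n)) := fun m j => by
    rw [planeWave_add_single (hζ n), zpow_natCast, mul_pow, cellRoot_pow hq, one_mul, hz]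
  -- The columns of `E` are plane waves satisfying the Floquet condition, hence eigenfunctions of
  -- the Laplacian.
  have hDE : floquetMatrix q V k * E =
      E * diagonal a + diagonal (fun x => V (cellPoint x)) * E := by
    ext x n
    simp only [Matrix.mul_apply (M := floquetMatrix q V k), hE]
    rw [floquetMatrix_mulVec hq (hfl n), schrodinger, laplacian_planeWave (hζ n), Matrix.add_apply,
      mul_diagonal, diagonal_mul, hE, mul_comm]
  have hEK : E * fourierPotential q V = diagonal (fun x => V (cellPoint x)) * E := by
    have h1 := mul_eq_one_comm.1 (inv_smul_conjTranspose_mul_fourierMatrix hq)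
    simp only [E, fourierPotential]
    rw [mul_assoc (diagonal G), ← mul_assoc (fourierMatrix q), ← mul_assoc (fourierMatrix q), h1,
      one_mul, ← mul_assoc, ← mul_assoc, diagonal_mul_diagonal, diagonal_mul_diagonal]
    simp only [mul_comm]
  have hdet : E.det ≠ 0 := by
    rw [det_mul, det_diagonal]
    refine mul_ne_zero (Finset.prod_ne_zero_iff.2 fun x _ =>
      Finset.prod_ne_zero_iff.2 fun j _ => pow_ne_zero _ (hz0 j)) fun h0 => ?_
    have := congrArg det (inv_smul_conjTranspose_mul_fourierMatrix hq)
    rw [det_mul, h0, mul_zero, det_one] at this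
    exact zero_ne_one this
  refine mul_right_cancel₀ hdet ?_
  rw [dispersion, ← det_mul, mul_comm (det _) (det E), ← det_mul, sub_mul, hDE, mul_add, mul_sub,
    hEK, Matrix.smul_mul, Matrix.mul_smul, one_mul, mul_one, add_sub_assoc]

end PeriodicSchrodinger

end

/-! ### Real potentials and the conclusion. -/

noncomputable section

namespace PeriodicSchrodinger

open Matrix

variable {d : ℕ} {q : Fin d → ℕ}

theorem fourierPotential_conj (V : (Fin d → ℤ) → ℝ) (n m : Cell q) :
    fourierPotential q (fun x => (V x : ℂ)) m n =
      (starRingEnd ℂ) (fourierPotential q (fun x => (V x : ℂ)) n m) := by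
  rw [fourierPotential_apply, fourierPotential_apply]
  simp only [map_mul, map_sum, map_inv₀, Complex.conj_natCast, Complex.conj_ofReal,
    Complex.conj_conj]
  congr 1
  exact Finset.sum_congr rfl fun x _ => by ring

theorem fourierPotential_diag (hq : ∀ j, 0 < q j) (V : (Fin d → ℤ) → ℝ) (n : Cell q) :
    fourierPotential q (fun x => (V x : ℂ)) n n = (average q V : ℂ) := by
  rw [fourierPotential_apply, average]
  push_cast
  rw [one_div]
  congr 1
  refine Finset.sum_congr rfl fun x _ => ?_
  have h : ‖fourierMatrix q x n‖ = 1 := by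
    simp [fourierMatrix, norm_prod, norm_cellRoot hq]
  rw [mul_right_comm, ← Complex.normSq_eq_conj_mul_self, Complex.normSq_eq_norm_sq, h]
  simp

/-- A periodic potential whose Fourier matrix has a diagonal row is constant. -/
theorem eq_average_of_fourierPotential_row (hq : ∀ j, 0 < q j) {V : (Fin d → ℤ) → ℝ}
    (hV : IsPeriodic q V) {n₀ : Cell q} (hn₀ : cellRoot n₀ = 1)
    (h : ∀ m, m ≠ n₀ → fourierPotential q (fun x => (V x : ℂ)) n₀ m = 0) (x : Fin d → ℤ) :
    V x = average q V := by
  have hF (x : Cell q) : fourierMatrix q x n₀ = 1 := by simp [fourierMatrix, hn₀]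
  -- The row at zero frequency is, up to the factor `Q⁻¹`, the discrete Fourier transform of `V`; it
  -- agrees with that of the constant `average q V`.
  have hvec : (fun x : Cell q => ((V (cellPoint x) : ℂ) - average q V)) ᵥ* fourierMatrix q = 0 := by
    funext m
    have h1 : fourierPotential q (fun x => (V x : ℂ)) n₀ m =
        fourierPotential q (fun _ => (average q V : ℂ)) n₀ m := by
      by_cases hm : m = n₀
      · rw [hm, fourierPotential_diag hq, fourierPotential_const hq]
        simp
      · rw [h m hm, fourierPotential_const hq, Matrix.smul_apply, one_apply_ne (Ne.symm hm),
          smul_zero]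
    rw [fourierPotential_apply, fourierPotential_apply] at h1
    have h2 := mul_left_cancel₀ (inv_ne_zero (cellCard_ne_zero hq)) h1
    simp only [hF, map_one, one_mul] at h2
    simp only [vecMul, dotProduct, sub_mul, Finset.sum_sub_distrib, h2, sub_self, Pi.zero_apply]
  have hinv := mul_eq_one_comm.1 (inv_smul_conjTranspose_mul_fourierMatrix hq)
  have hzero := congrArg (· ᵥ* (((∏ j, q j : ℕ) : ℂ)⁻¹ • (fourierMatrix q)ᴴ)) hvec
  simp only [vecMul_vecMul, hinv, vecMul_one, zero_vecMul] at hzero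
  have hfl : IsFloquet q 0 fun x => ((V x : ℂ) - average q V) := fun m j => by
    simp [hV m j]
  have := hfl.eq_zero hq (congrFun hzero) x
  exact_mod_cast sub_eq_zero.1 this

/-- Partial Fermi isospectrality to a constant potential along three coordinates forces a periodic
real potential to be constant. -/
theorem eq_average_of_genPartiallyFermiIsospectral (hq : ∀ j, 0 < q j)
    (hcop : ∀ i j, i ≠ j → Nat.Coprime (q i) (q j)) {V : (Fin d → ℤ) → ℝ} (hV : IsPeriodic q V)
    {Y₀ : ℝ} {lam₁ lam₂ : ℂ} {S : Finset (Fin d)} (hS : 3 ≤ S.card)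
    (h : GenPartiallyFermiIsospectral q (fun n => (V n : ℂ)) (fun _ => (Y₀ : ℂ)) lam₁ lam₂ S) :
    (∀ n, V n = average q V) ∧ (average q V : ℂ) = Y₀ + lam₁ - lam₂ := by
  classical
  obtain ⟨-, kstar, hk⟩ := h
  let e : Fin 3 ↪ Fin d := (S.orderEmbOfCardLe hS).toEmbedding
  have heS (i) : e i ∈ S := Finset.orderEmbOfCardLe_mem S hS i
  let ρ : Cell q → Fin 3 → ℂ := fun n i => cellRoot n (e i)
  let phase (k : Fin d → ℝ) (j : Fin d) : ℂ :=
    Complex.exp (2 * Real.pi * Complex.I * k j / q j)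
  -- Coordinates of `S` beyond the three chosen ones are also frozen at `kstar`.
  let c : Cell q → ℂ := fun n => ∑ j ∈ (Finset.univ.map e)ᶜ,
    (cellRoot n j * phase kstar j + (cellRoot n j * phase kstar j)⁻¹)
  let n₀ : Cell q := fun j => ⟨0, hq j⟩
  have hn₀ : cellRoot n₀ = 1 := by
    funext j
    simp [cellRoot, n₀]
  have hqne (j) : (q j : ℂ) ≠ 0 := Nat.cast_ne_zero.2 (hq j).ne'
  have hdisp (z : Fin 3 → ℂ) (hz : ∀ i, ‖z i‖ = 1) : ∃ k : Fin d → ℝ,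
      (∀ j, j ∉ S → k j = kstar j) ∧ ∀ (U : (Fin d → ℤ) → ℂ) (lam : ℂ),
        dispersion q U (fun j => (k j : ℂ)) lam =
          (diagonal (fun n => ∑ i, (ρ n i * z i + (ρ n i * z i)⁻¹)) + (diagonal c +
            (fourierPotential q U - lam • (1 : Matrix (Cell q) (Cell q) ℂ)))).det := by
    -- The factor `q (e i)` makes `exp (2πi k / q)`, rather than `exp (2πi k)`, equal to `z i`.
    let k : Fin d → ℝ := Function.extend e
      (fun i => q (e i) * (Complex.arg (z i) / (2 * Real.pi))) kstar
    have hke (i) : k (e i) = q (e i) * (Complex.arg (z i) / (2 * Real.pi)) :=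
      e.injective.extend_apply _ _ i
    have hkn (j) (hj : j ∉ Finset.univ.map e) : k j = kstar j :=
      Function.extend_apply' _ _ _ fun ⟨i, hi⟩ => hj (by simp [← hi])
    refine ⟨k, fun j hj => hkn j fun hj' => ?_, fun U lam => ?_⟩
    · obtain ⟨i, -, rfl⟩ := Finset.mem_map.1 hj'
      exact hj (heS i)
    · have hphase (i) : phase k (e i) = z i := by
        have h1 : 2 * Real.pi * Complex.I * (k (e i) : ℂ) / q (e i) =
            Complex.arg (z i) * Complex.I := by
          have := hqne (e i)
          have : (Real.pi : ℂ) ≠ 0 := Complex.ofReal_ne_zero.2 Real.pi_ne_zero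
          rw [hke]
          push_cast
          field_simp
        have h2 := Complex.norm_mul_exp_arg_mul_I (z i)
        rw [hz, Complex.ofReal_one, one_mul] at h2
        simp only [phase, h1, h2]
      rw [dispersion_eq hq U _ (phase k) (fun j => Complex.exp_ne_zero _) (fun j => by
        rw [← Complex.exp_nat_mul, mul_div_cancel₀ _ (hqne j)]), ← add_assoc (diagonal _),
        diagonal_add]
      congr 3
      funext n
      rw [← Finset.sum_add_sum_compl (Finset.univ.map e), Finset.sum_map]
      congr 1
      · simp only [hphase, ρ]
      · refine Finset.sum_congr rfl fun j hj => ?_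
        have : phase k j = phase kstar j := by
          simp only [phase, hkn j (Finset.mem_compl.1 hj)]
        rw [this]
  obtain ⟨hκ, hrow⟩ := row_eq_of_floquet_det_eq (q := q ∘ e) (ρ := ρ) (fun i => hq _)
    (fun i j hij => hcop _ _ (e.injective.ne hij)) (fun n i => cellRoot_pow hq n _)
    (fourierPotential q (fun n => (V n : ℂ)) - lam₁ • (1 : Matrix (Cell q) (Cell q) ℂ))
    (average q V - lam₁) (Y₀ - lam₂) c
    (fun n => by
      rw [Matrix.sub_apply, fourierPotential_diag hq, Matrix.smul_apply, one_apply_eq, smul_eq_mul,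
        mul_one])
    (fun n m hnm => by
      simp only [Matrix.sub_apply, Matrix.smul_apply, one_apply_ne hnm, one_apply_ne hnm.symm,
        smul_zero, sub_zero]
      exact fourierPotential_conj V n m)
    (fun z hz => by
      obtain ⟨k, hkS, hkU⟩ := hdisp z hz
      rw [← hkU, hk k hkS, hkU, fourierPotential_const hq, ← sub_smul, smul_one_eq_diagonal,
        diagonal_add c])
    (n₀ := n₀) (funext fun i => congrFun hn₀ (e i))
  refine ⟨eq_average_of_fourierPotential_row hq hV hn₀ fun m hm => ?_, ?_⟩
  · have := hrow m hm
    rwa [Matrix.sub_apply, Matrix.smul_apply, one_apply_ne hm.symm, smul_zero, sub_zero] at this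
  · linear_combination hκ

end PeriodicSchrodinger

end

open PeriodicSchrodinger in
theorem mainTheorem7 {d : ℕ} (hd : 2 ≤ d) (q : Fin d → ℕ) (hq : ∀ j, 0 < q j)
    (hcop : ∀ i j, i ≠ j → Nat.Coprime (q i) (q j))
    (V : (Fin d → ℤ) → ℝ) (hV : IsPeriodic q V) (Y₀ : ℝ)
    (lam₁ lam₂ : Fin d → Fin d → ℂ) (S : Fin d → Fin d → Finset (Fin d))
    (hiso : ∀ s t : Fin d, s < t →
      s ∈ S s t ∧ t ∈ S s t ∧ 3 ≤ (S s t).card ∧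
        GenPartiallyFermiIsospectral q (fun n => (V n : ℂ)) (fun _ => (Y₀ : ℂ))
          (lam₁ s t) (lam₂ s t) (S s t)) :
    (∀ n, V n = average q V) ∧
      ∀ s t : Fin d, s < t → ∀ n, (V n : ℂ) = (Y₀ : ℂ) + lam₁ s t - lam₂ s t := by
  have key (s t : Fin d) (hst : s < t) :=
    eq_average_of_genPartiallyFermiIsospectral hq hcop hV (hiso s t hst).2.2.1
      (hiso s t hst).2.2.2
  refine ⟨(key ⟨0, by omega⟩ ⟨1, by omega⟩ (by simp [Fin.lt_def])).1, fun s t hst n => ?_⟩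
  rw [(key s t hst).1 n, (key s t hst).2]
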